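/- Theorem t (Road coloring theorem). Let $\Gamma$ be an AGW graph of outdegree $d$, that is, a finite, strongly connected directed graph (loops and parallel edges are allowed) in which every vertex has exactly $d$ outgoing edges and in which the greatest common divisor of the lengths of all cycles is $1$. Then $\Gamma$ has a synchronizing coloring: the edges can be colored with $d$ colors so that the $d$ edges leaving each vertex have pairwise distinct colors, and so that the resulting deterministic complete automaton, whose states are the vertices of $\Gamma$ and whose letters are the colors, has a synchronizing word, i.e. there is a nonempty word $s$ in the colors such that following, from each vertex, the edges colored by the successive letters of $s$ leads to one and the same vertex. -/

import Mathlib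

universe u v

namespace RoadColoring

/-- The lengths of the cycles (closed directed walks of positive length) of a directed multigraph.
Every such walk splits into simple cycles, so the gcd of this set is also the gcd of the lengths of
the simple cycles. -/
def cycleLengths (V : Type u) [Quiver.{v} V] : Set ℕ :=
  {n | 0 < n ∧ ∃ (a : V) (p : Quiver.Path a a), p.length = n}

/-- An AGW graph of outdegree `d`: a finite strongly connected directed graph (loops and parallel
edges allowed) in which every vertex has exactly `d` outgoing edges and the gcd of the lengths of
all cycles is one. `Quiver.Star a` is the type of edges that leave `a`. -/
structure IsAGW (V : Type u) [Quiver.{v} V] (d : ℕ) : Prop where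
  finite_vertices : Finite V
  finite_edges : ∀ a : V, Finite (Quiver.Star a)
  stronglyConnected : Quiver.IsStronglyConnected V
  outdegree_eq : ∀ a : V, Nat.card (Quiver.Star a) = d
  gcd_cycleLengths : Nat.setGcd (cycleLengths V) = 1

/-- A coloring of the edges with colors from `A` that makes the graph a deterministic complete
automaton over the alphabet `A`: among the edges that leave a vertex, each color occurs exactly
once. -/
def Coloring (V : Type u) [Quiver.{v} V] (A : Type*) :=
  ∀ a : V, Quiver.Star a ≃ A

namespace Coloring

variable {V : Type u} [Quiver.{v} V] {A : Type*}

/-- The state reached from `p` along the edge with color `x`. -/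
def step (c : Coloring V A) (p : V) (x : A) : V :=
  ((c p).symm x).1

/-- The state `ps` reached from `p` along the edges colored by the letters of the word `s`,
read from left to right. -/
def run (c : Coloring V A) (p : V) (s : List A) : V :=
  s.foldl c.step p

/-- A synchronizing word: a nonempty word that maps the set of all states onto a single state. -/
def IsSynchronizingWord (c : Coloring V A) (s : List A) : Prop :=
  s ≠ [] ∧ (Set.range fun p : V => c.run p s).ncard = 1

/-- A coloring is synchronizing if its automaton has a synchronizing word. -/
def IsSynchronizing (c : Coloring V A) : Prop :=
  ∃ s : List A, c.IsSynchronizingWord s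

end Coloring

end RoadColoring

/-!
The proof follows Trahtman. A pair of states of an automaton is stable if it can be merged after
every word. Stability is a congruence (Culik, Karhumäki, Kari), and the quotient of a primitive
(strongly connected and aperiodic) graph by it is primitive again. If stability is not trivial, the quotient has a synchronizing
recoloring by induction on the number of vertices; recoloring all vertices of a class alike lifts it
to the graph, and since words that read the same classes are translated alike, states of a class can
still be merged. So it is enough to color the graph so that some pair of distinct states is stable
(`IsPrimitive.exists_recolor_stable`).

One letter acts as a function `f` that chooses an out-neighbor of each vertex; its graph consists of
cycles with trees attached. If all vertices of maximal positive level lie in a single tree, there is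
a stable pair (`exists_stable_of_hasTallTree`): a word of minimal rank can be arranged to have one
such vertex in its image, and powers of the letter give two minimal images that differ in one state
only.

To find such a choice, take `f` with as many periodic points as possible. If all points are
periodic, redirecting any vertex to another out-neighbor opens a cycle into a single branch; if no
vertex has another out-neighbor, the graph is a cycle, and aperiodicity leaves one vertex. Otherwise
let `p` be a vertex of maximal level `l`, with root `r`, and `u → p` an edge. Redirecting `u` to `p`
yields a single highest tree, or more periodic points, unless `u` is the vertex at distance `l + 1`
before `r` on the cycle of `r` (`IsExtremal.update_of_adj`). In that case `r` has two predecessors,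
on the path from `p` and on the cycle, and redirecting `u` exchanges their roles. If one of them had
an out-neighbor other than `r`, redirecting it there would contradict the choice of `f` or the
position of `u` (`IsExtremal.eq_root_of_adj`). So all their edges lead to `r`, and the two
predecessors form a stable pair under every coloring.
-/

namespace RoadColoring
open Function

/-! ### Levels and roots in the graph of a function -/

section FunctionalGraph

variable {α : Type*} {f : α → α}

/-- The number of steps from `z` to the cycle below it in the graph of `f`. If the orbit of `z`
never becomes periodic, which does not happen on finite types, this is zero. -/
noncomputable def level (f : α → α) (z : α) : ℕ := sInf {k | f^[k] z ∈ periodicPts f}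

/-- The first periodic point in the orbit of `z`. -/
noncomputable def root (f : α → α) (z : α) : α := f^[level f z] z

/-- Some vertices have a level greater than `l`, and all of these have the same root. In
particular all vertices of maximal level, which is positive, lie in a single tree. -/
def HasTallTree (f : α → α) : Prop :=
  ∃ (l : ℕ) (r : α), (∃ z, l < level f z) ∧ ∀ z, l < level f z → root f z = r

theorem iterate_mem_periodicPts {z : α} (hz : z ∈ periodicPts f) (n : ℕ) :
    f^[n] z ∈ periodicPts f := by
  obtain ⟨m, hm, h⟩ := hz
  exact ⟨m, hm, h.apply_iterate n⟩

theorem mem_periodicPts_of_iterate_eq {z : α} {m n : ℕ} (hmn : m < n) (h : f^[m] z = f^[n] z) :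
    f^[m] z ∈ periodicPts f := by
  refine ⟨n - m, by omega, ?_⟩
  rw [IsPeriodicPt, IsFixedPt, ← iterate_add_apply, Nat.sub_add_cancel hmn.le, h]

theorem iterate_ne_of_notMem {u z : α} (hu : u ∉ periodicPts f) (hz : z ∈ periodicPts f) (i : ℕ) :
    f^[i] z ≠ u := fun h => hu (h ▸ iterate_mem_periodicPts hz i)

theorem level_le {z : α} {k : ℕ} (h : f^[k] z ∈ periodicPts f) : level f z ≤ k := Nat.sInf_le h

theorem iterate_notMem_of_lt_level {z : α} {k : ℕ} (h : k < level f z) :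
    f^[k] z ∉ periodicPts f := fun h' => (level_le h').not_gt h

theorem exists_first_iterate {z u : α} (h : ∃ k, f^[k] z = u) :
    ∃ k, f^[k] z = u ∧ ∀ i < k, f^[i] z ≠ u := by
  classical
  exact ⟨Nat.find h, Nat.find_spec h, fun i hi => Nat.find_min h hi⟩

/-- A periodic point whose orbit meets `u` lies on the cycle of `u`, and the shortest path
to it from `f u` does not come back to `u` before. -/
theorem exists_first_return {z u : α} {a : ℕ} (hz : z ∈ periodicPts f) (ha : f^[a] z = u) :
    ∃ b, f^[b] (f u) = z ∧ (∀ i < b, f^[i] (f u) ≠ z) ∧ ∀ i < b, f^[i] (f u) ≠ u := by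
  have h : ∃ b, f^[b] (f u) = z := by
    obtain ⟨m, hm, h⟩ := hz
    refine ⟨m * (a + 1) - (a + 1), ?_⟩
    rw [← ha, ← iterate_succ_apply' f, ← iterate_add_apply]
    rw [Nat.sub_add_cancel (Nat.le_mul_of_pos_left _ hm)]
    exact h.mul_const (a + 1)
  obtain ⟨b, hb, hmin⟩ := exists_first_iterate h
  refine ⟨b, hb, hmin, fun i hi h' => hmin (b - (i + 1)) (by omega) ?_⟩
  conv_lhs => rw [← h', ← iterate_succ_apply' f i, ← iterate_add_apply]
  rw [← hb]
  congr 2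
  omega

theorem iterate_injOn_of_lt_level {z : α} :
    Set.InjOn (fun i : ℕ => f^[i] z) (Set.Iio (level f z)) := by
  intro a ha b hb h
  rcases lt_trichotomy a b with hab | hab | hab
  · exact absurd (mem_periodicPts_of_iterate_eq hab h) (iterate_notMem_of_lt_level ha)
  · exact hab
  · exact absurd (mem_periodicPts_of_iterate_eq hab h.symm) (iterate_notMem_of_lt_level hb)

theorem root_mem_periodicPts [Finite α] (z : α) : root f z ∈ periodicPts f := by
  have hne : {k : ℕ | f^[k] z ∈ periodicPts f}.Nonempty := by
    obtain ⟨m, n, hmn, h⟩ := Finite.exists_ne_map_eq_of_infinite (fun n : ℕ => f^[n] z)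
    rcases lt_or_gt_of_ne hmn with hmn | hmn
    · exact ⟨m, mem_periodicPts_of_iterate_eq hmn h⟩
    · exact ⟨n, mem_periodicPts_of_iterate_eq hmn h.symm⟩
  exact Nat.sInf_mem hne

variable [Finite α]

theorem level_pos_iff {z : α} : 0 < level f z ↔ z ∉ periodicPts f := by
  refine ⟨fun h => iterate_notMem_of_lt_level h, fun h => ?_⟩
  by_contra h'
  have := root_mem_periodicPts (f := f) z
  rw [root, Nat.eq_zero_of_not_pos h'] at this
  exact h this

theorem lt_level_iff {z : α} {k : ℕ} : k < level f z ↔ f^[k] z ∉ periodicPts f := by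
  refine ⟨iterate_notMem_of_lt_level, fun h => ?_⟩
  by_contra! h'
  apply h
  have := iterate_mem_periodicPts (root_mem_periodicPts (f := f) z) (k - level f z)
  rwa [root, ← iterate_add_apply, Nat.sub_add_cancel h'] at this

theorem level_eq_add {z : α} {k : ℕ} (hk : k ≤ level f z) :
    level f z = k + level f (f^[k] z) := by
  apply le_antisymm
  · apply level_le
    rw [add_comm, iterate_add_apply]
    exact root_mem_periodicPts _
  · have : level f (f^[k] z) ≤ level f z - k := by
      apply level_le
      rw [← iterate_add_apply, Nat.sub_add_cancel hk]
      exact root_mem_periodicPts _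
    omega

theorem root_iterate {z : α} {k : ℕ} (hk : k ≤ level f z) : root f (f^[k] z) = root f z := by
  rw [root, root, level_eq_add hk, ← iterate_add_apply, add_comm]

theorem level_eq_of_iterate {z : α} {k : ℕ} (h : f^[k] z ∈ periodicPts f)
    (h' : ∀ i < k, f^[i] z ∉ periodicPts f) : level f z = k := by
  refine le_antisymm (level_le h) ?_
  by_contra! hlt
  exact h' _ hlt (root_mem_periodicPts _)

end FunctionalGraph

/-! ### Redirecting one vertex -/

section Update

variable {α : Type*} [DecidableEq α] {f : α → α} {u x z : α}

theorem iterate_update {k : ℕ} (h : ∀ i < k, f^[i] z ≠ u) :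
    (update f u x)^[k] z = f^[k] z := by
  induction k with
  | zero => rfl
  | succ k ih =>
    rw [iterate_succ_apply', iterate_succ_apply', ih fun i hi => h i (by omega),
      update_of_ne (h k (by omega))]

theorem mem_periodicPts_update_iff (h : ∀ i, f^[i] z ≠ u) :
    z ∈ periodicPts (update f u x) ↔ z ∈ periodicPts f := by
  simp only [periodicPts, Set.mem_ofPred_eq, IsPeriodicPt, IsFixedPt,
    iterate_update (x := x) fun i (_ : i < _) => h i]

theorem level_update (h : ∀ i, f^[i] z ≠ u) : level (update f u x) z = level f z := by
  unfold level
  congr 1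
  ext k
  rw [Set.mem_ofPred_eq, Set.mem_ofPred_eq, iterate_update fun i _ => h i,
    mem_periodicPts_update_iff fun i => by rw [← iterate_add_apply]; exact h _]

theorem root_update (h : ∀ i, f^[i] z ≠ u) : root (update f u x) z = root f z := by
  rw [root, root, level_update h, iterate_update fun i _ => h i]

theorem periodicPts_subset_update (hu : u ∉ periodicPts f) :
    periodicPts f ⊆ periodicPts (update f u x) := fun _ hz =>
  (mem_periodicPts_update_iff (iterate_ne_of_notMem hu hz)).2 hz

theorem notMem_periodicPts_update (hx : ∀ i, f^[i] x ≠ u) :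
    u ∉ periodicPts (update f u x) := by
  rintro ⟨n, hn, h⟩
  obtain ⟨m, rfl⟩ := Nat.exists_eq_succ_of_ne_zero hn.ne'
  rw [IsPeriodicPt, IsFixedPt, iterate_succ_apply, update_self, iterate_update fun i _ => hx i] at h
  exact hx m h

variable [Finite α]

theorem level_root_update_of_iterate_eq (hx : ∀ i, f^[i] x ≠ u) {k : ℕ}
    (hz : ∀ i < k, f^[i] z ≠ u) (hzu : f^[k] z = u) :
    level (update f u x) z = k + (1 + level f x) ∧ root (update f u x) z = root f x := by
  have hg : (update f u x)^[k] z = u := (iterate_update hz).trans hzu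
  have hu := notMem_periodicPts_update hx
  have h1 : k ≤ level (update f u x) z := (lt_level_iff.2 (by rwa [hg])).le
  have h2 : 1 ≤ level (update f u x) u := level_pos_iff.2 hu
  have h3 : (update f u x)^[1] u = x := by simp
  constructor
  · rw [level_eq_add h1, hg, level_eq_add h2, h3, level_update hx]
  · rw [← root_iterate h1, hg, ← root_iterate h2, h3, root_update hx]

/-- Redirecting `u` to a vertex `x` whose orbit misses `u` plants the tree above `u` on top of
`x`. If that makes some vertex higher than all vertices of `f`, then every such vertex passes
through `u`, hence has the root of `x`. -/
theorem hasTallTree_update (hx : ∀ i, f^[i] x ≠ u) {k l : ℕ} (hl : ∀ y, level f y ≤ l)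
    (hz : ∀ i < k, f^[i] z ≠ u) (hzu : f^[k] z = u) (hlt : l < k + (1 + level f x)) :
    HasTallTree (update f u x) := by
  refine ⟨l, root f x, ⟨z, ?_⟩, fun y hy => ?_⟩
  · rwa [(level_root_update_of_iterate_eq hx hz hzu).1]
  · by_cases h : ∃ k, f^[k] y = u
    · obtain ⟨k, hk, hmin⟩ := exists_first_iterate h
      exact (level_root_update_of_iterate_eq hx hmin hk).2
    · push Not at h
      rw [level_update h] at hy
      exact absurd hy (hl y).not_gt

/-- Redirecting a non-periodic vertex to one above it closes a new cycle and keeps the old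
ones. -/
theorem ncard_periodicPts_lt_update (hu : u ∉ periodicPts f) (hx : ∃ m, f^[m] x = u) :
    (periodicPts f).ncard < (periodicPts (update f u x)).ncard := by
  obtain ⟨m, hm, hmin⟩ := exists_first_iterate hx
  refine Set.ncard_lt_ncard ⟨periodicPts_subset_update hu, fun h => hu (h ?_)⟩ (Set.toFinite _)
  refine ⟨m + 1, by omega, ?_⟩
  rw [IsPeriodicPt, IsFixedPt, iterate_succ_apply, update_self, iterate_update hmin, hm]

/-- When `f` consists of cycles only, redirecting `u` opens a cycle into a single branch that
starts at the former successor of `u`. -/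
theorem hasTallTree_update_of_forall_mem (hf : ∀ z, z ∈ periodicPts f) (hx : x ≠ f u) :
    HasTallTree (update f u x) := by
  have hq : f u ∉ periodicPts (update f u x) := by
    intro h
    obtain ⟨y, -, hy⟩ := (bijOn_periodicPts (update f u x)).surjOn h
    by_cases hyu : y = u
    · subst hyu
      rw [update_self] at hy
      exact hx hy
    · rw [update_of_ne hyu] at hy
      exact hyu ((bijOn_periodicPts f).injOn (hf _) (hf _) hy)
  refine ⟨0, root (update f u x) (f u), ⟨f u, level_pos_iff.2 hq⟩, fun z hz => ?_⟩
  rw [level_pos_iff] at hz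
  have h : ∃ a, f^[a] z = u := by
    by_contra! h
    exact hz ((mem_periodicPts_update_iff h).2 (hf z))
  obtain ⟨a, ha⟩ := h
  obtain ⟨b, hb, -, hbu⟩ := exists_first_return (hf z) ha
  rw [← iterate_update (x := x) hbu] at hb
  rw [← hb] at hz ⊢
  exact root_iterate (lt_level_iff.2 hz).le

/-- Redirecting `u`, on the cycle below `p`, to `p` itself replaces the arc from `f u` to the
root of `p` by the path from `p` to that root; the arc becomes a branch at the root. -/
theorem update_of_mem_cycle {p : α} (hu : u ∈ periodicPts f) (hpu : ∃ k, f^[k] p = u)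
    (hp : 0 < level f p) (hmax : ∀ z, level f z ≤ level f p) :
    (∀ z, level f p < level (update f u p) z → root (update f u p) z = root f p) ∧
    (periodicPts f).ncard + level f p ≤
      (periodicPts (update f u p)).ncard + level (update f u p) (f u) ∧
    root (update f u p) (f u) = root f p ∧
    ∀ i ≤ level (update f u p) (f u), (update f u p)^[i] (f u) = f^[i] (f u) := by
  have hr := root_mem_periodicPts (f := f) p
  have hru : ∃ n, f^[n] (root f p) = u := by
    obtain ⟨k, hk⟩ := hpu
    have : level f p ≤ k := level_le (by rwa [hk])
    refine ⟨k - level f p, ?_⟩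
    rw [root, ← iterate_add_apply, Nat.sub_add_cancel this, hk]
  obtain ⟨n, hn, hnmin⟩ := exists_first_iterate hru
  obtain ⟨j, hj, -, hju⟩ := exists_first_return hr hn
  set g := update f u p with hg
  have hgu : g u = p := by rw [hg, update_self]
  have hout : ∀ z, ∀ i ≤ level f z, g^[i] z = f^[i] z := fun z i hi =>
    iterate_update fun i' hi' h => iterate_notMem_of_lt_level (hi'.trans_le hi) (h ▸ hu)
  have hgr : ∀ i ≤ n, g^[i] (root f p) = f^[i] (root f p) := fun i hi =>
    iterate_update fun i' hi' => hnmin i' (by omega)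
  have hgv : ∀ i ≤ j, g^[i] (f u) = f^[i] (f u) := fun i hi =>
    iterate_update fun i' hi' => hju i' (by omega)
  have hgp : g^[level f p] p = root f p := hout p _ le_rfl
  have hpper : p ∈ periodicPts g := by
    refine ⟨n + 1 + level f p, by omega, ?_⟩
    rw [IsPeriodicPt, IsFixedPt, iterate_add_apply, hgp, iterate_succ_apply', hgr n le_rfl, hn, hgu]
  have hrper : root f p ∈ periodicPts g := hgp ▸ iterate_mem_periodicPts hpper _
  -- the vertices that drop out of the cycles lie on the arc from `f u` to the root of `p`
  have hdrop : ∀ z ∈ periodicPts f, z ∉ periodicPts g → ∃ i < j, f^[i] (f u) = z := by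
    intro z hz hz'
    have h : ∃ a, f^[a] z = u := by
      by_contra! h
      exact hz' ((mem_periodicPts_update_iff h).2 hz)
    obtain ⟨a, ha⟩ := h
    obtain ⟨i, hi, himin, -⟩ := exists_first_return hz ha
    refine ⟨i, ?_, hi⟩
    by_contra! hij
    have hzr : f^[i - j] (root f p) = z := by
      rw [← hj, ← iterate_add_apply, Nat.sub_add_cancel hij, hi]
    by_cases hin : i - j ≤ n
    · rw [← hgr _ hin] at hzr
      exact hz' (hzr ▸ iterate_mem_periodicPts hrper _)
    · refine himin (i - j - (n + 1)) (by omega) ?_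
      conv_lhs => rw [← hn, ← iterate_succ_apply' f, ← iterate_add_apply]
      rw [← hzr]
      congr 2
      omega
  -- on the cycles of `g` the root of `p` has only one predecessor, and that is not periodic
  -- for `f`, unlike the points of the arc
  have harc : ∀ i < j, g^[i] (f u) ∉ periodicPts g := by
    intro i hi h
    have h1 : g^[j - 1] (f u) ∈ periodicPts g := by
      have := iterate_mem_periodicPts h (j - 1 - i)
      rwa [← iterate_add_apply, Nat.sub_add_cancel (by omega)] at this
    have h2 : g^[level f p - 1] p ∈ periodicPts g := iterate_mem_periodicPts hpper _
    have h3 : g^[j - 1] (f u) = g^[level f p - 1] p := by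
      apply (bijOn_periodicPts g).injOn h1 h2
      rw [← iterate_succ_apply' g, ← iterate_succ_apply' g, Nat.succ_eq_add_one,
        Nat.succ_eq_add_one, Nat.sub_add_cancel (by omega), Nat.sub_add_cancel (by omega), hgp,
        hgv j le_rfl, hj]
    rw [hgv _ (by omega), hout p _ (by omega)] at h3
    refine iterate_notMem_of_lt_level (show level f p - 1 < level f p by omega) (h3 ▸ ?_)
    rw [← iterate_succ_apply]
    exact iterate_mem_periodicPts hu _
  have hlev : level g (f u) = j :=
    level_eq_of_iterate (by rwa [hgv j le_rfl, hj]) harc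
  have hroot : root g (f u) = root f p := by rw [root, hlev, hgv j le_rfl, hj]
  refine ⟨fun z hz => ?_, ?_, hroot, fun i hi => hgv i (hlev ▸ hi)⟩
  · have hc : g^[level f z] z = root f z := hout z _ le_rfl
    have hcg : root f z ∉ periodicPts g := fun h =>
      ((level_le (hc.symm ▸ h)).trans (hmax z)).not_gt hz
    obtain ⟨i, hi, hiz⟩ := hdrop _ (root_mem_periodicPts z) hcg
    have hlz : level f z ≤ level g z := (lt_level_iff.2 (hc.symm ▸ hcg)).le
    rw [← root_iterate hlz, hc, ← hiz, ← hgv i hi.le, root_iterate (hlev ▸ hi.le), hroot]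
  · rw [hlev]
    let P : Set α := (fun i => f^[i] p) '' Set.Iio (level f p)
    let Q : Set α := (fun i => f^[i] (f u)) '' Set.Iio j
    have hP : P.ncard = level f p := by
      rw [iterate_injOn_of_lt_level.ncard_image, Set.ncard_eq_toFinset_card']
      simp
    have hQ : Q.ncard ≤ j := by
      refine (Set.ncard_image_le (Set.toFinite _)).trans ?_
      rw [Set.ncard_eq_toFinset_card']
      simp
    have hPg : P ⊆ periodicPts g := by
      rintro _ ⟨i, hi, rfl⟩
      change f^[i] p ∈ _
      rw [← hout p i (le_of_lt hi)]
      exact iterate_mem_periodicPts hpper i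
    have hPf : Disjoint (periodicPts f) P := by
      rw [Set.disjoint_right]
      rintro _ ⟨i, hi, rfl⟩
      exact iterate_notMem_of_lt_level hi
    have hsub : periodicPts f ∪ P ⊆ periodicPts g ∪ Q := by
      rintro z (hz | hz)
      · by_cases h : z ∈ periodicPts g
        · exact Or.inl h
        · obtain ⟨i, hi, hiz⟩ := hdrop z hz h
          exact Or.inr ⟨i, hi, hiz⟩
      · exact Or.inl (hPg hz)
    have := Set.ncard_le_ncard hsub (Set.toFinite _)
    rw [Set.ncard_union_eq hPf (Set.toFinite _) (Set.toFinite _), hP] at this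
    exact this.trans ((Set.ncard_union_le _ _).trans (by omega))

end Update

/-! ### Extremal choices of out-neighbors -/

section Extremal

variable {α : Type*} [DecidableEq α]

/-- A choice `f` of one out-neighbor for each vertex of the graph `E` that has as many periodic
points as possible and whose trees have height at most `l`. -/
structure IsExtremal (E : α → α → Prop) (f : α → α) (l : ℕ) : Prop where
  adj : ∀ u, E u (f u)
  ncard_le : ∀ g : α → α, (∀ u, E u (g u)) → (periodicPts g).ncard ≤ (periodicPts f).ncard
  level_bound : ∀ z, level f z ≤ l

theorem adj_update {E : α → α → Prop} {f : α → α} (hf : ∀ u, E u (f u)) {u x : α} (hx : E u x) :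
    ∀ v, E v (update f u x v) := by
  intro v
  by_cases h : v = u
  · subst h; rwa [update_self]
  · rw [update_of_ne h]; exact hf v

variable [Finite α] {E : α → α → Prop} {f : α → α} {l : ℕ} {p u : α}

/-- If no choice has a tall tree, an edge `u → p` to a highest vertex `p` of an extremal choice
starts on the cycle below `p`, at distance `l + 1` before the root. Redirecting `u` to `p`
gives an extremal choice again, with `f u` as a highest vertex. -/
theorem IsExtremal.update_of_adj (hf : IsExtremal E f l)
    (hno : ∀ g : α → α, (∀ u, E u (g u)) → ¬ HasTallTree g) (hl : 0 < l) (hp : level f p = l)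
    (hup : E u p) :
    u ∈ periodicPts f ∧ f^[l + 1] u = root f p ∧ IsExtremal E (update f u p) l ∧
      level (update f u p) (f u) = l ∧ root (update f u p) (f u) = root f p ∧
      (update f u p)^[l - 1] (f u) = f^[l - 1] (f u) := by
  have hadj := adj_update hf.adj hup
  have hpu : ∃ k, f^[k] p = u := by
    by_contra! h
    exact hno _ hadj (hasTallTree_update h (k := 0) (z := u) hf.level_bound (by simp) rfl (by omega))
  have hu : u ∈ periodicPts f := by
    by_contra h
    exact (ncard_periodicPts_lt_update h hpu).not_ge (hf.ncard_le _ hadj)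
  obtain ⟨h1, h2, h3, h4⟩ := update_of_mem_cycle hu hpu (by omega) (hp ▸ hf.level_bound)
  have hle : ∀ z, level (update f u p) z ≤ l := by
    by_contra! h
    exact hno _ hadj ⟨l, root f p, h, hp ▸ h1⟩
  have hcard := hf.ncard_le _ hadj
  have hlev : level (update f u p) (f u) = l := le_antisymm (hle _) (by omega)
  refine ⟨hu, ?_, ⟨hadj, fun g hg => (hf.ncard_le g hg).trans (by omega), hle⟩, hlev, h3,
    h4 _ (by omega)⟩
  rw [← h3, root, h4 _ le_rfl, hlev, iterate_succ_apply]

/-- Redirecting the last vertex `s` before the root of `p` to another out-neighbor `x` would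
either close an additional cycle, or raise the tree above `s`, or move it to the root `x`. In the
last case an edge `u → p` would start at distance `l + 1` before both roots. -/
theorem IsExtremal.eq_root_of_adj (hf : IsExtremal E f l)
    (hno : ∀ g : α → α, (∀ u, E u (g u)) → ¬ HasTallTree g) (hl : 0 < l) (hp : level f p = l)
    (hup : E u p) {x : α} (hx : E (f^[l - 1] p) x) : x = root f p := by
  obtain ⟨hu, hur, -⟩ := hf.update_of_adj hno hl hp hup
  set s := f^[l - 1] p with hs
  have hsper : s ∉ periodicPts f := iterate_notMem_of_lt_level (by omega)
  have hps : ∀ i < l - 1, f^[i] p ≠ s := fun i hi h => by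
    have := iterate_injOn_of_lt_level (f := f) (z := p) (Set.mem_Iio.2 (by omega : i < level f p))
      (Set.mem_Iio.2 (by omega : l - 1 < level f p)) h
    omega
  have hadj := adj_update hf.adj hx
  have hxs : ∀ i, f^[i] x ≠ s := by
    intro i hi
    exact (ncard_periodicPts_lt_update hsper ⟨i, hi⟩).not_ge (hf.ncard_le _ hadj)
  have hxper : x ∈ periodicPts f := by
    by_contra h
    rw [← level_pos_iff] at h
    exact hno _ hadj (hasTallTree_update hxs hf.level_bound hps hs.symm (by omega))
  have hx0 : level f x = 0 := Nat.le_zero.1 (level_le hxper)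
  have hxr : root f x = x := by rw [root, hx0, iterate_zero_apply]
  have hsl : level f s = 1 := by
    have := level_eq_add (f := f) (z := p) (k := l - 1) (by omega)
    rw [← hs] at this
    omega
  have hg : IsExtremal E (update f s x) l := by
    refine ⟨hadj, fun g hg => (hf.ncard_le g hg).trans
      (Set.ncard_le_ncard (periodicPts_subset_update hsper) (Set.toFinite _)), fun z => ?_⟩
    by_cases h : ∃ k, f^[k] z = s
    · obtain ⟨k, hk, hmin⟩ := exists_first_iterate h
      rw [(level_root_update_of_iterate_eq hxs hmin hk).1, hx0]
      have hkz : k ≤ level f z := (lt_level_iff.2 (by rwa [hk])).le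
      have := level_eq_add hkz
      rw [hk, hsl] at this
      exact this ▸ hf.level_bound z
    · push Not at h
      rw [level_update h]
      exact hf.level_bound z
  obtain ⟨hpl, hpr⟩ := level_root_update_of_iterate_eq hxs hps hs.symm
  obtain ⟨-, hur', -⟩ := hg.update_of_adj hno hl (by omega) hup
  rw [iterate_update fun i _ => iterate_ne_of_notMem hsper hu i, hur, hpr, hxr] at hur'
  exact hur'.symm

/-- Every finite graph without sources and sinks has a choice of out-neighbors with a tall tree,
or two vertices with the same single out-neighbor, or it is the graph of a function. -/
theorem exists_hasTallTree_or (hout : ∀ u, ∃ v, E u v) (hin : ∀ v, ∃ u, E u v) :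
    (∃ f : α → α, (∀ u, E u (f u)) ∧ HasTallTree f) ∨
      (∃ s t r, s ≠ t ∧ (∀ x, E s x → x = r) ∧ ∀ x, E t x → x = r) ∨
      ∃ f : α → α, ∀ u v, E u v → v = f u := by
  by_cases hno : ∃ f : α → α, (∀ u, E u (f u)) ∧ HasTallTree f
  · exact Or.inl hno
  -- no choice has a tall tree; take one with the most periodic points
  right
  push Not at hno
  have : Nonempty {f : α → α // ∀ u, E u (f u)} := by
    choose f hf using hout
    exact ⟨⟨f, hf⟩⟩
  obtain ⟨⟨f, hf⟩, hmax⟩ :=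
    Finite.exists_max fun f : {f : α → α // ∀ u, E u (f u)} => (periodicPts f.1).ncard
  rcases isEmpty_or_nonempty α with hα | hα
  · exact Or.inr ⟨id, fun u => isEmptyElim u⟩
  obtain ⟨p, hp⟩ := Finite.exists_max (level f)
  rcases Nat.eq_zero_or_pos (level f p) with h0 | hl
  · right
    refine ⟨f, fun u v huv => ?_⟩
    by_contra h
    refine hno _ (adj_update hf huv) (hasTallTree_update_of_forall_mem (fun z => ?_) h)
    by_contra hz
    have := level_pos_iff.2 hz
    have := hp z
    omega
  -- the two predecessors of the root of `p` are the last vertices of the path from `p` and of the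
  -- arc from `f u`, which becomes a path of the same kind when `u` is redirected to `p`
  · left
    have hext : IsExtremal E f (level f p) := ⟨hf, fun g hg => hmax ⟨g, hg⟩, hp⟩
    obtain ⟨u, hup⟩ := hin p
    obtain ⟨hu, -, hg, hgl, hgr, hgi⟩ := hext.update_of_adj hno hl rfl hup
    refine ⟨f^[level f p - 1] p, f^[level f p - 1] (f u), root f p, fun h => ?_,
      fun x hx => hext.eq_root_of_adj hno hl rfl hup hx, fun x hx => ?_⟩
    · refine iterate_notMem_of_lt_level (show level f p - 1 < level f p by omega) (h ▸ ?_)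
      rw [← iterate_succ_apply]
      exact iterate_mem_periodicPts hu _
    · rw [← hgr]
      exact hg.eq_root_of_adj hno hl hgl (hf u) (by rwa [hgi])

end Extremal

/-! ### Stable pairs and minimal images -/

section Automaton

variable {V A : Type*} {δ : V → A → V}

/-- A pair of states is stable if after every word it can still be merged. -/
def Stable (δ : V → A → V) (p q : V) : Prop :=
  ∀ u : List A, ∃ v : List A, (u ++ v).foldl δ p = (u ++ v).foldl δ q

theorem Stable.trans {p q r : V} (h : Stable δ p q) (h' : Stable δ q r) : Stable δ p r := by
  intro u
  obtain ⟨v, hv⟩ := h u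
  obtain ⟨w, hw⟩ := h' (u ++ v)
  refine ⟨v ++ w, ?_⟩
  rw [← List.append_assoc, ← hw, List.foldl_append, hv, ← List.foldl_append]

/-- Stability as an equivalence relation on the states. -/
def stableSetoid (δ : V → A → V) : Setoid V where
  r := Stable δ
  iseqv :=
    { refl := fun _ _ => ⟨[], rfl⟩
      symm := fun h u => (h u).imp fun _ hv => hv.symm
      trans := Stable.trans }

theorem Stable.step {p q : V} (h : Stable δ p q) (a : A) : Stable δ (δ p a) (δ q a) :=
  fun u => h (a :: u)

/-- The quotient automaton by stability. -/
def stableQuotient (δ : V → A → V) (c : Quotient (stableSetoid δ)) (a : A) :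
    Quotient (stableSetoid δ) :=
  c.map (fun p => δ p a) fun _ _ h => Stable.step h a

theorem foldl_replicate (δ : V → A → V) (a : A) (n : ℕ) (p : V) :
    (List.replicate n a).foldl δ p = (fun x => δ x a)^[n] p := by
  induction n generalizing p with
  | zero => rfl
  | succ n ih => rw [List.replicate_succ, List.foldl_cons, ih, iterate_succ_apply]

theorem range_foldl_append (δ : V → A → V) (w u : List A) :
    (Set.range fun p => (w ++ u).foldl δ p) =
      (fun p => u.foldl δ p) '' Set.range fun p => w.foldl δ p := by
  rw [← Set.range_comp]
  simp only [List.foldl_append, comp_def]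

/-- A word of minimal rank: its image has the least possible number of states. -/
def IsMinimalRank (δ : V → A → V) (w : List A) : Prop :=
  ∀ u : List A, (Set.range fun p => w.foldl δ p).ncard ≤ (Set.range fun p => u.foldl δ p).ncard

theorem exists_isMinimalRank (δ : V → A → V) : ∃ w, IsMinimalRank δ w :=
  ⟨argmin fun w : List A => (Set.range fun p => w.foldl δ p).ncard,
    fun u => argmin_le (fun w : List A => (Set.range fun p => w.foldl δ p).ncard) u⟩

variable [Finite V]

theorem IsMinimalRank.append {w : List A} (hw : IsMinimalRank δ w) (u : List A) :
    IsMinimalRank δ (w ++ u) := by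
  intro v
  rw [range_foldl_append]
  exact (Set.ncard_image_le (Set.toFinite _)).trans (hw v)

theorem IsMinimalRank.injOn {w : List A} (hw : IsMinimalRank δ w) (u : List A) :
    Set.InjOn (fun p => u.foldl δ p) (Set.range fun p => w.foldl δ p) := by
  rw [← Set.ncard_image_iff (Set.toFinite _), ← range_foldl_append]
  exact le_antisymm (hw.append u w) (hw _)

/-- Two minimal images that differ in one state only: both are mapped onto a common
minimal image, injectively, so the states in which they differ are merged. -/
theorem IsMinimalRank.stable {w w' : List A} {R : Set V} {p q : V} (hw : IsMinimalRank δ w)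
    (hw' : IsMinimalRank δ w') (hR : (Set.range fun x => w.foldl δ x) = insert p R)
    (hR' : (Set.range fun x => w'.foldl δ x) = insert q R) (hp : p ∉ R) : Stable δ p q := by
  intro u
  refine ⟨w, ?_⟩
  have key : ∀ v, IsMinimalRank δ v → (fun x => (u ++ w).foldl δ x) ''
      (Set.range fun x => v.foldl δ x) = Set.range fun x => w.foldl δ x := by
    intro v hv
    refine Set.eq_of_subset_of_ncard_le ?_ ?_ (Set.toFinite _)
    · rintro _ ⟨x, -, rfl⟩
      exact ⟨u.foldl δ x, List.foldl_append.symm⟩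
    · rw [← range_foldl_append]
      exact hw _
  have hmem : (u ++ w).foldl δ p ∈ (fun x => (u ++ w).foldl δ x) '' insert q R := by
    rw [← hR', key w' hw', ← key w hw, hR]
    exact ⟨p, Set.mem_insert _ _, rfl⟩
  obtain ⟨x, rfl | hx, hxp⟩ := hmem
  · exact hxp.symm
  · refine absurd ?_ hp
    have := hw.injOn (u ++ w) (hR ▸ Set.mem_insert_of_mem _ hx) (hR ▸ Set.mem_insert p R) hxp
    exact this ▸ hx

/-- A minimal image through a highest vertex of the tall tree contains no other vertex of that
height. After all its other vertices have reached cycles of `a`, a high power of `a` fixes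
these and moves only the remaining one. -/
theorem exists_stable_of_hasTallTree (hconn : ∀ p q, ∃ w : List A, w.foldl δ p = q) (a : A)
    (h : HasTallTree fun x => δ x a) : ∃ p q, p ≠ q ∧ Stable δ p q := by
  have := Fintype.ofFinite V
  set f : V → V := fun x => δ x a with hf
  obtain ⟨l, r, ⟨z, hz⟩, hr⟩ := h
  have : Nonempty V := ⟨z⟩
  obtain ⟨p, hp⟩ := Finite.exists_max (level f)
  have hlp : l < level f p := hz.trans_le (hp z)
  obtain ⟨w, hw⟩ := exists_isMinimalRank δ
  obtain ⟨u, hu⟩ := hconn (w.foldl δ p) p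
  replace hw := hw.append u
  have hpw : p ∈ Set.range fun x => (w ++ u).foldl δ x := ⟨p, by simpa using hu⟩
  set w₁ := w ++ u
  set P := Set.range fun x => w₁.foldl δ x with hP
  set R := f^[level f p - 1] '' (P \ {p})
  have hRper : ∀ x ∈ R, x ∈ periodicPts f := by
    rintro _ ⟨q, ⟨hq, hqp⟩, rfl⟩
    by_contra hqper
    rw [← lt_level_iff] at hqper
    have hql : level f q = level f p := le_antisymm (hp q) (by omega)
    have h1 : root f q = root f p := (hr q (by omega)).trans (hr p hlp).symm
    rw [root, root, hql, ← foldl_replicate δ a, ← foldl_replicate δ a] at h1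
    exact hqp (hw.injOn _ hq hpw h1)
  have hp' : f^[level f p - 1] p ∉ periodicPts f := iterate_notMem_of_lt_level (by omega)
  have h2 : (Set.range fun x => (w₁ ++ List.replicate (level f p - 1) a).foldl δ x) =
      insert (f^[level f p - 1] p) R := by
    rw [range_foldl_append, ← Set.image_insert_eq, Set.insert_sdiff_singleton,
      Set.insert_eq_of_mem hpw]
    simp only [foldl_replicate, ← hf, ← hP]
  have h3 : (Set.range fun x => (w₁ ++ List.replicate (level f p - 1) a ++
      List.replicate (Fintype.card V).factorial a).foldl δ x) =
      insert (f^[(Fintype.card V).factorial] (f^[level f p - 1] p)) R := by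
    rw [range_foldl_append, h2, Set.image_insert_eq]
    simp only [foldl_replicate, ← hf]
    congr 1
    refine (Set.image_congr fun x hx => ?_).trans (Set.image_id R)
    exact isPeriodicPt_factorial_card_of_mem_periodicPts (hRper x hx)
  refine ⟨_, _, fun h => hp' ?_, (hw.append _).stable ((hw.append _).append _) h2 h3
    fun h => hp' (hRper _ h)⟩
  exact ⟨_, Nat.factorial_pos _, h.symm⟩

end Automaton

/-! ### Recoloring and the quotient by stability -/

section Recoloring

variable {V C A : Type*}

/-- The automaton obtained from `e` by permuting the colors of the edges that leave each
state. -/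
def recolor (e : V → A → V) (π : V → Equiv.Perm A) (p : V) (a : A) : V := e p (π p a)

theorem map_foldl {δ : V → A → V} {δ' : C → A → C} {h : V → C}
    (hh : ∀ p a, h (δ p a) = δ' (h p) a) (w : List A) (p : V) :
    h (w.foldl δ p) = w.foldl δ' (h p) := by
  induction w generalizing p with
  | nil => rfl
  | cons a w ih => rw [List.foldl_cons, List.foldl_cons, ih, hh]

/-- If the recoloring at a state depends on its class only, and the classes form a quotient
automaton, then a word is translated in the same way for all states of a class. -/
theorem exists_foldl_recolor_eq {δ : V → A → V} {δ' : C → A → C} {h : V → C}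
    (hh : ∀ p a, h (δ p a) = δ' (h p) a) (π : C → Equiv.Perm A) (w : List A) (c : C) :
    ∃ w' : List A, w'.length = w.length ∧ ∀ p, h p = c →
      w'.foldl (recolor δ fun p => π (h p)) p = w.foldl δ p := by
  induction w generalizing c with
  | nil => exact ⟨[], rfl, fun _ _ => rfl⟩
  | cons a w ih =>
    obtain ⟨w', hl, hw'⟩ := ih (δ' c a)
    refine ⟨(π c).symm a :: w', by simp [hl], fun p hp => ?_⟩
    have : recolor δ (fun p => π (h p)) p ((π c).symm a) = δ p a := by
      rw [recolor, hp, Equiv.apply_symm_apply]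
    rw [List.foldl_cons, List.foldl_cons, this, hw' _ (by rw [hh, hp])]

/-- The graph whose edges lead from each `p` to the vertices `e p a` is strongly connected, and
the lengths of its closed walks have no common divisor but one. -/
structure IsPrimitive (e : V → A → V) : Prop where
  connected : ∀ p q, ∃ w : List A, w.foldl e p = q
  aperiodic : ∀ N, (∀ (p : V) (w : List A), w.foldl e p = p → N ∣ w.length) → N = 1

theorem IsPrimitive.isPrimitive_recolor {e : V → A → V} (he : IsPrimitive e) (π : V → Equiv.Perm A) :
    IsPrimitive (recolor e π) := by
  refine ⟨fun p q => ?_, fun N hN => he.aperiodic N fun p w hw => ?_⟩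
  · obtain ⟨w, hw⟩ := he.connected p q
    obtain ⟨w', -, hw'⟩ := exists_foldl_recolor_eq (δ := e) (h := id) (fun _ _ => rfl) π w p
    exact ⟨w', (hw' p rfl).trans hw⟩
  · obtain ⟨w', hl, hw'⟩ := exists_foldl_recolor_eq (δ := e) (h := id) (fun _ _ => rfl) π w p
    exact hl ▸ hN p w' ((hw' p rfl).trans hw)

theorem IsPrimitive.of_surjective {δ : V → A → V} {δ' : C → A → C} (hδ : IsPrimitive δ) {h : V → C}
    (hh : ∀ p a, h (δ p a) = δ' (h p) a) (hs : Surjective h) : IsPrimitive δ' := by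
  refine ⟨fun c c' => ?_, fun N hN => hδ.aperiodic N fun p w hw => hN (h p) w ?_⟩
  · obtain ⟨p, rfl⟩ := hs c
    obtain ⟨q, rfl⟩ := hs c'
    obtain ⟨w, hw⟩ := hδ.connected p q
    exact ⟨w, by rw [← map_foldl hh, hw]⟩
  · rw [← map_foldl hh, hw]

/-- A synchronizing word of a quotient automaton, read after a word `w` of minimal rank, leads all
states into one class. They are then equal, because no two states of a minimal image can be
merged. -/
theorem exists_synchronizing_of_quotient [Finite V] {δ : V → A → V} {δ' : C → A → C} {h : V → C}
    (hh : ∀ p a, h (δ p a) = δ' (h p) a)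
    (hmerge : ∀ p q, h p = h q → ∃ w : List A, w.foldl δ p = w.foldl δ q) {w₀ : List A}
    (hw₀ : ∀ c c', w₀.foldl δ' c = w₀.foldl δ' c') :
    ∃ w : List A, ∀ p q, w.foldl δ p = w.foldl δ q := by
  obtain ⟨w, hw⟩ := exists_isMinimalRank δ
  refine ⟨w ++ w₀, fun p q => ?_⟩
  obtain ⟨u, hu⟩ := hmerge ((w ++ w₀).foldl δ p) ((w ++ w₀).foldl δ q) (by
    rw [map_foldl hh, map_foldl hh, List.foldl_append, List.foldl_append]
    exact hw₀ _ _)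
  exact (hw.append w₀).injOn u ⟨p, rfl⟩ ⟨q, rfl⟩ hu

/-- In an aperiodic strongly connected graph with at least two vertices, the out-neighbors are
not all unique: otherwise the graph would be a single cycle. -/
theorem IsPrimitive.not_forall_eq [Nontrivial V] {e : V → A → V}
    (he : IsPrimitive e) (f : V → V) :
    ¬ ∀ p a, e p a = f p := by
  intro hf
  have hfold : ∀ (w : List A) p, w.foldl e p = f^[w.length] p := by
    intro w
    induction w with
    | nil => exact fun _ => rfl
    | cons a w ih => intro p; rw [List.foldl_cons, ih, hf, List.length_cons, iterate_succ_apply]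
  have hconn : ∀ p q, ∃ n, f^[n] p = q := fun p q => by
    obtain ⟨w, hw⟩ := he.connected p q
    exact ⟨_, hfold w p ▸ hw⟩
  obtain ⟨p₀, q₀, hne⟩ := exists_pair_ne V
  have h1 : minimalPeriod f p₀ = 1 := by
    refine he.aperiodic _ fun p w hw => IsPeriodicPt.minimalPeriod_dvd ?_
    obtain ⟨j, rfl⟩ := hconn p p₀
    rw [hfold] at hw
    exact IsPeriodicPt.apply_iterate hw j
  obtain ⟨n, hn⟩ := hconn p₀ q₀
  exact hne ((iterate_fixed (minimalPeriod_eq_one_iff_isFixedPt.1 h1) n).symm.trans hn)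

theorem IsPrimitive.exists_recolor_stable [Finite V] [Nontrivial V] {e : V → A → V}
    (he : IsPrimitive e) :
    ∃ (π : V → Equiv.Perm A) (p q : V), p ≠ q ∧ Stable (recolor e π) p q := by
  classical
  obtain ⟨p₀, q₀, hne⟩ := exists_pair_ne V
  obtain ⟨a₀⟩ : Nonempty A := by
    obtain ⟨_ | ⟨a, _⟩, hw⟩ := he.connected p₀ q₀
    · exact absurd hw hne
    · exact ⟨a⟩
  have hin : ∀ q, ∃ p a, e p a = q := by
    intro q
    obtain ⟨w, hw⟩ := he.connected (e q a₀) q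
    rcases List.eq_nil_or_concat w with rfl | ⟨w, a, rfl⟩
    · exact ⟨q, a₀, hw⟩
    · rw [List.concat_eq_append, List.foldl_append] at hw
      exact ⟨_, a, hw⟩
  rcases exists_hasTallTree_or (E := fun p q => ∃ a, e p a = q) (fun p => ⟨_, a₀, rfl⟩) hin with
    ⟨f, hf, htall⟩ | ⟨s, t, r, hst, hs, ht⟩ | ⟨f, hf⟩
  · choose b hb using hf
    refine ⟨fun p => Equiv.swap a₀ (b p), ?_⟩
    have : (fun p => recolor e (fun p => Equiv.swap a₀ (b p)) p a₀) = f := by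
      funext p
      rw [recolor, Equiv.swap_apply_left, hb]
    exact exists_stable_of_hasTallTree (he.isPrimitive_recolor _).connected a₀ (this.symm ▸ htall)
  · refine ⟨fun _ => 1, s, t, hst, fun u => ⟨[a₀], ?_⟩⟩
    have h : ∀ a, recolor e (fun _ => 1) s a = recolor e (fun _ => 1) t a := fun a =>
      (hs _ ⟨_, rfl⟩).trans (ht _ ⟨_, rfl⟩).symm
    cases u with
    | nil => exact h a₀
    | cons a u => rw [List.cons_append, List.foldl_cons, List.foldl_cons, h]
  · exact absurd (fun p a => hf p _ ⟨a, rfl⟩) (he.not_forall_eq f)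

/-- The road coloring theorem for a graph given by one of its colorings `e`. By induction on the
number of vertices: the quotient by a nontrivial stability relation has a synchronizing
recoloring, which is lifted by recoloring all vertices of a class alike. -/
theorem IsPrimitive.exists_recolor_synchronizing {V : Type u} {A : Type*} [Finite V] {e : V → A → V}
    (he : IsPrimitive e) :
    ∃ (π : V → Equiv.Perm A) (w : List A), ∀ p q,
      w.foldl (recolor e π) p = w.foldl (recolor e π) q := by
  induction hn : Nat.card V using Nat.strong_induction_on generalizing V with
  | _ n ih =>
  rcases subsingleton_or_nontrivial V with hV | hV
  · exact ⟨fun _ => 1, [], fun p q => Subsingleton.elim _ _⟩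
  obtain ⟨π, p₀, q₀, hne, hst⟩ := he.exists_recolor_stable
  have hh : ∀ p a, Quotient.mk (stableSetoid (recolor e π)) (recolor e π p a) =
      stableQuotient (recolor e π) (Quotient.mk _ p) a := fun _ _ => rfl
  have hcard : Nat.card (Quotient (stableSetoid (recolor e π))) < n := by
    rw [← hn]
    refine (Nat.card_le_card_of_surjective _ Quotient.mk_surjective).lt_of_ne fun h => hne ?_
    exact (Quotient.mk_surjective.bijective_of_nat_card_le h.ge).injective (Quotient.sound hst)
  obtain ⟨π', w₀, hw₀⟩ := ih _ hcard ((he.isPrimitive_recolor π).of_surjective hh Quotient.mk_surjective) rfl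
  obtain ⟨w, hw⟩ := exists_synchronizing_of_quotient
    (δ := recolor (recolor e π) fun p => π' (Quotient.mk _ p)) (h := Quotient.mk _)
    (fun p a => hh p (π' (Quotient.mk _ p) a))
    (fun p q hpq => by
      obtain ⟨v, hv⟩ := Quotient.exact hpq []
      obtain ⟨v', -, hv'⟩ := exists_foldl_recolor_eq hh π' v (Quotient.mk _ p)
      exact ⟨v', by rw [hv' p rfl, hv' q hpq.symm]; exact hv⟩) hw₀
  exact ⟨fun p => π p * π' (Quotient.mk _ p), w, hw⟩

end Recoloring

/-! ### Directed multigraphs -/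

section Graph

variable {V : Type u} [Quiver.{v} V] {A : Type*}

theorem Coloring.exists_run_eq (c : Coloring V A) {p q : V} (γ : Quiver.Path p q) :
    ∃ w : List A, w.length = γ.length ∧ w.foldl c.step p = q := by
  induction γ with
  | nil => exact ⟨[], rfl, rfl⟩
  | @cons q r _ f ih =>
    obtain ⟨w, hl, hw⟩ := ih
    refine ⟨w ++ [c q ⟨r, f⟩], by simp [hl], ?_⟩
    rw [List.foldl_append, hw, List.foldl_cons, List.foldl_nil, Coloring.step,
      Equiv.symm_apply_apply]

end Graph
end RoadColoring

theorem theoremt (V : Type u) [Quiver.{v} V] (d : ℕ) (hV : RoadColoring.IsAGW V d) :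
    ∃ c : RoadColoring.Coloring V (Fin d), c.IsSynchronizing := by
  obtain ⟨hfin, hfin', hconn, hdeg, hgcd⟩ := hV
  let c₀ : RoadColoring.Coloring V (Fin d) := fun p => Finite.equivFinOfCardEq (hdeg p)
  obtain ⟨n, ⟨hn, p₀, γ₀, hγ₀⟩, -⟩ :=
    Nat.exists_ne_zero_of_setGcd_ne_zero (s := RoadColoring.cycleLengths V) (by omega)
  have hprim : RoadColoring.IsPrimitive c₀.step := by
    refine ⟨fun p q => (hconn p q).elim fun γ => (c₀.exists_run_eq γ).imp fun _ => And.right, fun N hN => ?_⟩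
    rw [← Nat.dvd_one, ← hgcd, Nat.dvd_setGcd_iff]
    rintro m ⟨-, p, γ, rfl⟩
    obtain ⟨w, hl, hw⟩ := c₀.exists_run_eq γ
    exact hl ▸ hN p w hw
  obtain ⟨a₀⟩ : Nonempty (Fin d) := by
    cases γ₀ with
    | nil => exact absurd hγ₀.symm (by simpa using hn.ne')
    | @cons q _ _ f => exact ⟨c₀ q ⟨_, f⟩⟩
  obtain ⟨π, w, hw⟩ := hprim.exists_recolor_synchronizing
  let c : RoadColoring.Coloring V (Fin d) := fun p => (c₀ p).trans (π p).symm
  -- the letter `a₀` makes the word nonempty when `w` is the empty word, for a single vertex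
  refine ⟨c, w ++ [a₀], by simp, Set.ncard_eq_one.2 ⟨c.run p₀ (w ++ [a₀]), ?_⟩⟩
  refine Set.eq_singleton_iff_unique_mem.2 ⟨⟨p₀, rfl⟩, ?_⟩
  rintro _ ⟨p, rfl⟩
  change (w ++ [a₀]).foldl c.step p = (w ++ [a₀]).foldl c.step p₀
  rw [List.foldl_append, List.foldl_append]
  exact congrArg (fun x => [a₀].foldl c.step x) (hw p p₀)
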